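/- Let $d$ be a natural number. For $y\in\mathbb{R}^d$ and $f\in L^2(\mathbb{R}^d)$ (complex-valued functions, Lebesgue measure) let $t_yf(x)=f(x-y)$, and let $\widehat f$ denote the Fourier transform of $f$, i.e. the unitary extension to $L^2(\mathbb{R}^d)$ of $\widehat f(\omega)=\int_{\mathbb{R}^d}f(x)\,e^{-2\pi i\langle\omega,x\rangle}\,dx$. For $\varphi\in L^2(\mathbb{R}^d)$ let $S(\varphi)=\overline{\operatorname{span}}\{t_k\varphi : k\in\mathbb{Z}^d\}$, the closure being taken in $L^2(\mathbb{R}^d)$. If $\varphi\in L^2(\mathbb{R}^d)$ and $S(\varphi)$ is $\mathbb{R}^d$-invariant, i.e. $t_xf\in S(\varphi)$ for all $x\in\mathbb{R}^d$ and all $f\in S(\varphi)$, then $$\bigl|\{\omega\in\mathbb{R}^d : \widehat\varphi(\omega)\neq 0\}\bigr|\le 1,$$ where $|\cdot|$ denotes Lebesgue measure. (The set is determined up to a null set.) -/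

import Mathlib

/-!
On the Fourier side `t_y` is multiplication by `ω ↦ exp (-2πi⟪y, ω⟫)`. For integral `y` this
multiplier is `ℤ^d`-periodic, so every `f ∈ S(φ)` satisfies `φ̂(ω - k) f̂(ω) = φ̂(ω) f̂(ω - k)` for
all `k ∈ ℤ^d`, a condition that survives `L²` limits. For `f = t_y φ` with `⟪y, k⟫ ∉ ℤ` the two
sides differ by the factor `exp (2πi⟪y, k⟫) ≠ 1`, which forces `φ̂(ω) φ̂(ω - k) = 0`. Hence the
`ℤ^d`-translates of the support of `φ̂` are disjoint up to null sets, so its measure is at most that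
of a unit cube.
-/

open MeasureTheory
open scoped FourierTransform ENNReal

noncomputable section

/-- The Hilbert space `L²(ℝ^d)` of complex-valued functions, with respect to Lebesgue measure. -/
abbrev L2 (d : ℕ) : Type :=
  Lp (α := EuclideanSpace ℝ (Fin d)) ℂ 2 volume

/-- The translation operator `(t_y f)(x) = f (x - y)` on `L²(ℝ^d)`. -/
def translation {d : ℕ} (y : EuclideanSpace ℝ (Fin d)) : L2 d →ₗᵢ[ℂ] L2 d :=
  Lp.compMeasurePreservingₗᵢ ℂ (fun x : EuclideanSpace ℝ (Fin d) => x - y)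
    (measurePreserving_sub_right volume y)

/-- A vector of integers, as a point of `ℝ^d`. -/
def intPoint {d : ℕ} (k : Fin d → ℤ) : EuclideanSpace ℝ (Fin d) :=
  WithLp.toLp 2 (fun i => (k i : ℝ))

/-- The shift-invariant space `S(Φ)` generated by `Φ ⊆ L²(ℝ^d)`: the closed linear span of
all integer translates of elements of `Φ`. -/
def shiftInvariantSpan {d : ℕ} (Φ : Set (L2 d)) : Submodule ℂ (L2 d) :=
  (Submodule.span ℂ
    {g : L2 d | ∃ φ ∈ Φ, ∃ k : Fin d → ℤ, g = translation (intPoint k) φ}).topologicalClosure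

/-- A subspace `S` of `L²(ℝ^d)` is `M`-invariant if `t_m f ∈ S` for all `m ∈ M` and `f ∈ S`. -/
def IsTranslationInvariant {d : ℕ} (M : AddSubgroup (EuclideanSpace ℝ (Fin d)))
    (S : Submodule ℂ (L2 d)) : Prop :=
  ∀ m ∈ M, ∀ f ∈ S, translation m f ∈ S

end

open Filter Topology
open scoped SchwartzMap RealInnerProductSpace Pointwise

section MulRelation

variable {α 𝕜 E : Type*} [MeasurableSpace α] {μ : Measure α} [NormedField 𝕜]
  [NormedAddCommGroup E] [NormedSpace 𝕜 E] {p q : ℝ≥0∞}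

variable (E μ p q) in
/-- The linear relation `{(f, g) | a f = b g a.e.}` between `L^p` and `L^q`. The multipliers `a` and
`b` are arbitrary functions: neither `a f` nor `b g` has to lie in any `L^r`. -/
def aeMulRelation (a b : α → 𝕜) : Submodule 𝕜 (Lp E p μ × Lp E q μ) where
  carrier := {F | ∀ᵐ x ∂μ, a x • F.1 x = b x • F.2 x}
  zero_mem' := by
    filter_upwards [Lp.coeFn_zero E p μ, Lp.coeFn_zero E q μ] with x h₁ h₂
    rw [Prod.fst_zero, Prod.snd_zero, h₁, h₂, Pi.zero_apply, smul_zero, smul_zero]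
  add_mem' := by
    intro F G hF hG
    filter_upwards [hF, hG, Lp.coeFn_add F.1 G.1, Lp.coeFn_add F.2 G.2] with x hF hG h₁ h₂
    rw [Prod.fst_add, Prod.snd_add, h₁, h₂, Pi.add_apply, Pi.add_apply, smul_add, smul_add, hF, hG]
  smul_mem' := by
    intro c F hF
    filter_upwards [hF, Lp.coeFn_smul c F.1, Lp.coeFn_smul c F.2] with x hF h₁ h₂
    rw [Prod.smul_fst, Prod.smul_snd, h₁, h₂, Pi.smul_apply, Pi.smul_apply, smul_comm, hF,
      smul_comm]

theorem mem_aeMulRelation {a b : α → 𝕜} {F : Lp E p μ × Lp E q μ} :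
    F ∈ aeMulRelation E μ p q a b ↔ ∀ᵐ x ∂μ, a x • F.1 x = b x • F.2 x :=
  Iff.rfl

theorem isClosed_aeMulRelation [Fact (1 ≤ p)] [Fact (1 ≤ q)] (a b : α → 𝕜) :
    IsClosed (aeMulRelation E μ p q a b : Set (Lp E p μ × Lp E q μ)) := by
  refine IsSeqClosed.isClosed fun F G hF hFG => ?_
  obtain ⟨ns, hns, h₁⟩ := (tendstoInMeasure_of_tendsto_Lp hFG.fst_nhds).exists_seq_tendsto_ae
  obtain ⟨ms, hms, h₂⟩ :=
    (tendstoInMeasure_of_tendsto_Lp (hFG.snd_nhds.comp hns.tendsto_atTop)).exists_seq_tendsto_ae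
  filter_upwards [h₁, h₂, ae_all_iff.2 hF] with x h₁ h₂ hF
  refine tendsto_nhds_unique ((h₁.comp hms.tendsto_atTop).const_smul (a x)) ?_
  exact (h₂.const_smul (b x)).congr fun n => (hF (ns (ms n))).symm

end MulRelation

section FourierShift

variable {V F : Type*} [NormedAddCommGroup V] [InnerProductSpace ℝ V] [FiniteDimensional ℝ V]
  [MeasurableSpace V] [BorelSpace V]

theorem fourier_compSubConstCLM_apply [NormedAddCommGroup F] [NormedSpace ℂ F] (y : V)
    (f : 𝓢(V, F)) (ω : V) :
    𝓕 (f.compSubConstCLM ℂ y) ω = Real.fourierChar (-⟪y, ω⟫) • 𝓕 f ω := by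
  have h := congrFun (VectorFourier.fourierIntegral_comp_add_right Real.fourierChar
    (volume : Measure V) (innerₗ V) f (-y)) ω
  rw [innerₗ_apply_apply, inner_neg_left] at h
  have hshift : (f.compSubConstCLM ℂ y : V → F) = f ∘ fun x => x + -y :=
    funext fun x => congrArg f (sub_eq_add_neg x y)
  rw [SchwartzMap.fourier_coe, SchwartzMap.fourier_coe, hshift]
  exact h

theorem coeFn_fourier_compMeasurePreserving_sub [NormedAddCommGroup F] [InnerProductSpace ℂ F]
    [CompleteSpace F] (y : V) (f : Lp (α := V) F 2) :
    (𝓕 (Lp.compMeasurePreservingₗᵢ ℂ (· - y) (measurePreserving_sub_right volume y) f) :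
      Lp (α := V) F 2) =ᵐ[volume]
      fun ω => Real.fourierChar (-⟪y, ω⟫) • (𝓕 f : Lp (α := V) F 2) ω := by
  let T : Lp (α := V) F 2 →ₗᵢ[ℂ] Lp (α := V) F 2 :=
    Lp.compMeasurePreservingₗᵢ ℂ (· - y) (measurePreserving_sub_right volume y)
  let R := aeMulRelation F (volume : Measure V) 2 2 1 fun ω => (Real.fourierChar (-⟪y, ω⟫) : ℂ)
  suffices h : (𝓕 (T f), 𝓕 f) ∈ R by
    filter_upwards [mem_aeMulRelation.1 h] with ω h
    rwa [Pi.one_apply, one_smul] at h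
  refine (SchwartzMap.denseRange_toLpCLM (p := 2) ENNReal.ofNat_ne_top).induction_on f
    (p := fun f => (𝓕 (T f), 𝓕 f) ∈ R) ?_ fun g => ?_
  · have hR : IsClosed (R : Set (Lp (α := V) F 2 × Lp (α := V) F 2)) := isClosed_aeMulRelation _ _
    have hT : Continuous T := T.continuous
    exact hR.preimage (f := fun f : Lp (α := V) F 2 => (𝓕 (T f), 𝓕 f)) (by fun_prop)
  · have hTg : T (g.toLp 2) = (g.compSubConstCLM ℂ y).toLp 2 := rfl
    simp only [SchwartzMap.toLpCLM_apply, hTg, SchwartzMap.toLp_fourier_eq]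
    filter_upwards [SchwartzMap.coeFn_toLp (𝓕 (g.compSubConstCLM ℂ y)) 2 volume,
      SchwartzMap.coeFn_toLp (𝓕 g) 2 volume] with ω h₁ h₂
    rw [h₁, h₂, Pi.one_apply, one_smul, fourier_compSubConstCLM_apply, Circle.smul_def]

end FourierShift

theorem exists_forall_inner_ne_intCast {V : Type*} [NormedAddCommGroup V]
    [InnerProductSpace ℝ V] {v : V} (hv : v ≠ 0) :
    ∃ y : V, ∀ n : ℤ, ⟪y, v⟫ ≠ n := by
  refine ⟨(2 * ‖v‖ ^ 2)⁻¹ • v, fun n hn => ?_⟩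
  have hv' : ‖v‖ ≠ 0 := norm_ne_zero_iff.2 hv
  have hhalf : ⟪(2 * ‖v‖ ^ 2)⁻¹ • v, v⟫ = 1 / 2 := by
    rw [real_inner_smul_left, real_inner_self_eq_norm_sq]
    field_simp
  have htwo : (1 : ℝ) = (2 * n : ℤ) := by
    push_cast
    linarith
  have : (1 : ℤ) = 2 * n := by exact_mod_cast htwo
  omega

theorem fourierChar_eq_one_iff {x : ℝ} : Real.fourierChar x = 1 ↔ ∃ n : ℤ, x = n := by
  rw [Real.fourierChar_apply', Circle.exp_eq_one]
  refine exists_congr fun n => ?_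
  rw [mul_comm, mul_left_inj' Real.two_pi_pos.ne']

section ShiftInvariantSpan

variable {d : ℕ} {φ f : L2 d}

theorem coeFn_translation (y : EuclideanSpace ℝ (Fin d)) (f : L2 d) :
    translation y f =ᵐ[volume] fun x => f (x - y) :=
  Lp.coeFn_compMeasurePreserving f (measurePreserving_sub_right volume y)

theorem coeFn_fourier_translation (y : EuclideanSpace ℝ (Fin d)) (f : L2 d) :
    (𝓕 (translation y f) : L2 d) =ᵐ[volume]
      fun ω => Real.fourierChar (-⟪y, ω⟫) * (𝓕 f : L2 d) ω :=
  coeFn_fourier_compMeasurePreserving_sub y f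

theorem coeFn_fourier_translation_sub (y v : EuclideanSpace ℝ (Fin d)) (f : L2 d) :
    (fun ω => (𝓕 (translation y f) : L2 d) (ω - v)) =ᵐ[volume]
      fun ω => Real.fourierChar ⟪y, v⟫ * (Real.fourierChar (-⟪y, ω⟫) * (𝓕 f : L2 d) (ω - v)) := by
  filter_upwards [(measurePreserving_sub_right volume v).quasiMeasurePreserving.ae
    (coeFn_fourier_translation y f)] with ω h
  rw [h, inner_sub_right, neg_sub, sub_eq_add_neg, AddChar.map_add_eq_mul, Circle.coe_mul,
    mul_assoc]

theorem intPoint_eq_zero_iff {k : Fin d → ℤ} : intPoint k = 0 ↔ k = 0 := by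
  simp [intPoint, funext_iff]

theorem inner_intPoint (k l : Fin d → ℤ) :
    ⟪intPoint k, intPoint l⟫ = ((∑ i, k i * l i : ℤ) : ℝ) := by
  simp [intPoint, PiLp.inner_apply, mul_comm]

theorem translation_intPoint_zero (f : L2 d) : translation (intPoint 0) f = f := by
  refine Lp.ext ?_
  filter_upwards [coeFn_translation (intPoint 0) f] with x hx
  rw [hx, intPoint_eq_zero_iff.2 rfl, sub_zero]

theorem subset_shiftInvariantSpan (Φ : Set (L2 d)) : Φ ⊆ shiftInvariantSpan Φ := fun φ hφ =>
  Submodule.le_topologicalClosure _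
    (Submodule.subset_span ⟨φ, hφ, 0, (translation_intPoint_zero φ).symm⟩)

theorem ae_fourier_sub_mul_fourier_eq_of_mem_shiftInvariantSpan
    (hf : f ∈ shiftInvariantSpan {φ}) (k : Fin d → ℤ) :
    ∀ᵐ ω, (𝓕 φ : L2 d) (ω - intPoint k) * (𝓕 f : L2 d) ω =
      (𝓕 φ : L2 d) ω * (𝓕 f : L2 d) (ω - intPoint k) := by
  let A : L2 d →L[ℂ] L2 d × L2 d := (FourierTransform.fourierCLM ℂ (L2 d)).prod
    ((translation (intPoint k)).toContinuousLinearMap ∘L FourierTransform.fourierCLM ℂ (L2 d))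
  let R := aeMulRelation ℂ volume 2 2 (fun ω => (𝓕 φ : L2 d) (ω - intPoint k)) (𝓕 φ : L2 d)
  have mem_comap_iff (g : L2 d) : g ∈ R.comap A.toLinearMap ↔
      ∀ᵐ ω, (𝓕 φ : L2 d) (ω - intPoint k) * (𝓕 g : L2 d) ω =
        (𝓕 φ : L2 d) ω * (𝓕 g : L2 d) (ω - intPoint k) := by
    refine mem_aeMulRelation.trans (eventually_congr ?_)
    filter_upwards [coeFn_translation (intPoint k) (𝓕 g : L2 d)] with ω h
    rw [← h]
    rfl
  refine (mem_comap_iff f).1 (Submodule.topologicalClosure_minimal _ (Submodule.span_le.2 ?_)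
    ((isClosed_aeMulRelation _ _).preimage A.continuous) hf)
  rintro _ ⟨ψ, hψ, l, rfl⟩
  obtain rfl := Set.mem_singleton_iff.1 hψ
  have hperiod : Real.fourierChar ⟪(intPoint l : EuclideanSpace ℝ (Fin d)), intPoint k⟫ = 1 :=
    fourierChar_eq_one_iff.2 ⟨_, inner_intPoint l k⟩
  refine (mem_comap_iff _).2 ?_
  filter_upwards [coeFn_fourier_translation (intPoint l) ψ,
    coeFn_fourier_translation_sub (intPoint l) (intPoint k) ψ] with ω h₁ h₂
  rw [h₁, h₂, hperiod, Circle.coe_one]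
  ring

theorem ae_fourier_mul_fourier_sub_eq_zero {y : EuclideanSpace ℝ (Fin d)}
    (hφ : translation y φ ∈ shiftInvariantSpan {φ}) {k : Fin d → ℤ}
    (hy : ∀ n : ℤ, ⟪y, intPoint k⟫ ≠ n) :
    ∀ᵐ ω, (𝓕 φ : L2 d) ω * (𝓕 φ : L2 d) (ω - intPoint k) = 0 := by
  have hχ : (1 - Real.fourierChar ⟪y, intPoint k⟫ : ℂ) ≠ 0 := by
    rw [sub_ne_zero, ne_comm, Ne, Circle.coe_eq_one, fourierChar_eq_one_iff]
    exact not_exists.2 hy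
  filter_upwards [ae_fourier_sub_mul_fourier_eq_of_mem_shiftInvariantSpan hφ k,
    coeFn_fourier_translation y φ, coeFn_fourier_translation_sub y (intPoint k) φ] with ω h h₁ h₂
  rw [h₁, h₂] at h
  refine (mul_eq_zero.1 ?_).resolve_left (mul_ne_zero hχ
    (Circle.coe_ne_zero (Real.fourierChar (-⟪y, ω⟫))))
  linear_combination h

end ShiftInvariantSpan

section IntegerPacking

theorem measure_le_of_forall_aedisjoint_vadd {G α : Type*} [AddGroup G] [Countable G]
    [AddAction G α] [MeasurableSpace α] [MeasurableConstVAdd G α] {μ : Measure α}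
    [VAddInvariantMeasure G α μ] {D s : Set α} (hD : IsAddFundamentalDomain G D μ)
    (hs : NullMeasurableSet s μ) (h : ∀ g : G, g ≠ 0 → AEDisjoint μ (g +ᵥ s) s) : μ s ≤ μ D :=
  hD.measure_le_of_pairwise_disjoint hs <|
    (Measure.pairwise_aedisjoint_of_aedisjoint_forall_ne_zero h fun g =>
      (measurePreserving_vadd g μ).quasiMeasurePreserving).mono fun _ _ h =>
        h.mono Set.inter_subset_left Set.inter_subset_left

theorem volume_fundamentalDomain_orthonormalBasis {ι E : Type*} [Fintype ι]
    [NormedAddCommGroup E] [InnerProductSpace ℝ E] [FiniteDimensional ℝ E] [MeasurableSpace E]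
    [BorelSpace E] (b : OrthonormalBasis ι ℝ E) :
    volume (ZSpan.fundamentalDomain b.toBasis) = 1 := by
  rw [measure_congr (ZSpan.fundamentalDomain_ae_parallelepiped _ volume), b.coe_toBasis,
    b.volume_parallelepiped]

variable {d : ℕ}

theorem exists_eq_intPoint_of_mem_span {v : EuclideanSpace ℝ (Fin d)}
    (hv : v ∈ Submodule.span ℤ (Set.range (EuclideanSpace.basisFun (Fin d) ℝ).toBasis)) :
    ∃ k : Fin d → ℤ, v = intPoint k := by
  choose k hk using (Module.Basis.mem_span_iff_repr_mem ..).1 hv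
  refine ⟨k, ?_⟩
  ext i
  simpa [intPoint] using (hk i).symm

theorem volume_le_one_of_forall_ae_sub_intPoint_notMem {s : Set (EuclideanSpace ℝ (Fin d))}
    (hs : NullMeasurableSet s)
    (h : ∀ k : Fin d → ℤ, k ≠ 0 → ∀ᵐ ω, ω ∈ s → ω - intPoint k ∉ s) :
    volume s ≤ 1 := by
  let b := EuclideanSpace.basisFun (Fin d) ℝ
  rw [← volume_fundamentalDomain_orthonormalBasis b]
  have : Countable (Submodule.span ℤ (Set.range b.toBasis)).toAddSubgroup :=
    inferInstanceAs (Countable (Submodule.span ℤ (Set.range b.toBasis)))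
  refine measure_le_of_forall_aedisjoint_vadd (ZSpan.isAddFundamentalDomain' b.toBasis volume) hs
    fun g hg => ?_
  obtain ⟨k, hk⟩ := exists_eq_intPoint_of_mem_span g.2
  have hk0 : k ≠ 0 := by
    rw [← intPoint_eq_zero_iff.ne, ← hk]
    exact fun h0 => hg (Subtype.ext h0)
  refine measure_mono_null ?_ (ae_iff.1 (h k hk0))
  rintro _ ⟨⟨x, hx, rfl⟩, hgx⟩ hnot
  refine hnot hgx ?_
  have : (g +ᵥ x) - intPoint k = x := by
    rw [← hk]
    exact add_sub_cancel_left (g : EuclideanSpace ℝ (Fin d)) x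
  rwa [this]

end IntegerPacking

theorem corollary5p4_general {d : ℕ} {φ : L2 d} {M : AddSubgroup (EuclideanSpace ℝ (Fin d))}
    (hM : ∀ k : Fin d → ℤ, k ≠ 0 → ∃ y ∈ M, ∀ n : ℤ, ⟪y, intPoint k⟫ ≠ n)
    (hφ : IsTranslationInvariant M (shiftInvariantSpan {φ})) :
    volume (Function.support (𝓕 φ : L2 d)) ≤ 1 := by
  have hsupp : NullMeasurableSet (Function.support (𝓕 φ : L2 d)) :=
    (Lp.stronglyMeasurable (𝓕 φ : L2 d)).measurableSet_support.nullMeasurableSet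
  refine volume_le_one_of_forall_ae_sub_intPoint_notMem hsupp fun k hk => ?_
  obtain ⟨y, hyM, hy⟩ := hM k hk
  have hmem : translation y φ ∈ shiftInvariantSpan {φ} :=
    hφ y hyM φ (subset_shiftInvariantSpan {φ} rfl)
  filter_upwards [ae_fourier_mul_fourier_sub_eq_zero hmem hy] with ω h h₁ h₂
  exact mul_ne_zero h₁ h₂ h

theorem corollary5p4 (d : ℕ) (φ : L2 d)
    (hφ : IsTranslationInvariant (⊤ : AddSubgroup (EuclideanSpace ℝ (Fin d)))
      (shiftInvariantSpan {φ})) :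
    volume (Function.support (𝓕 φ : L2 d)) ≤ 1 :=
  corollary5p4_general (fun _ hk => (exists_forall_inner_ne_intCast
    (intPoint_eq_zero_iff.ne.2 hk)).imp fun y hy => ⟨AddSubgroup.mem_top y, hy⟩) hφ
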